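/- Let $n\ge 2$ and $K>0$, let $(M,g)$ be a complete smooth $n$-dimensional Riemannian manifold with $\mathrm{Ric}\ge (n-1)K\,g$, and let $\Omega\subset M$ be a bounded domain (a bounded, connected, non-empty open set) with $C^1$ boundary. Let $dv$ be the Riemannian volume. Let $H^1(\Omega)$ and $H^2(\Omega)$ be the completions of the smooth functions on $\Omega$ of finite norm for the norms $\big(\int_\Omega |\nabla f|^2+f^2\,dv\big)^{1/2}$ and $\big(\int_\Omega |D^2f|^2+|\nabla f|^2+f^2\,dv\big)^{1/2}$, and let $\mathcal H^1(\Omega)$ be the completion of the smooth $1$-forms on $\Omega$ of finite norm for the norm $\big(\int_\Omega |\nabla\omega|^2+|\omega|^2\,dv\big)^{1/2}$, where $\nabla$ is the Levi-Civita connection. For $j\in\{1,2,\dots\}$ let $$\mu_j=\min_{\substack{U\subset H^2(\Omega)\\ \dim U=j}}\ \max_{0\neq u\in U}\frac{\int_\Omega |D^2u|^2+\mathrm{Ric}(\nabla u,\nabla u)\,dv}{\int_\Omega u^2\,dv},\qquad m_j=\min_{\substack{U\subset H^1(\Omega)\\ \dim U=j}}\ \max_{0\neq u\in U}\frac{\int_\Omega|\nabla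 u|^2\,dv}{\int_\Omega u^2\,dv}$$ be the $j$-th Neumann eigenvalues on $\Omega$ of the biharmonic operator and of the Laplacian, and let $$\eta_1=\min_{0\neq\omega\in\mathcal H^1(\Omega)}\frac{\int_\Omega|\nabla\omega|^2\,dv}{\int_\Omega|\omega|^2\,dv}$$ be the first Neumann eigenvalue of the rough Laplacian on $1$-forms of $\Omega$. Then, for all $j\ge 1$, $$\mu_j\ \ge\ \big(\eta_1+(n-1)K\big)\,m_j .$$ -/

import Mathlib

open scoped Manifold ContDiff Topology Bundle
open MeasureTheory Bundle

noncomputable section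

namespace NeumannBiharmonic

/-- The model space of an `n`-dimensional manifold. -/
abbrev Model (n : ℕ) : Type := EuclideanSpace ℝ (Fin n)

/-- The `i`-th partial derivative of a function on the model space. -/
def partialDeriv {n : ℕ} (i : Fin n) (F : Model n → ℝ) (y : Model n) : ℝ :=
  fderiv ℝ F y (EuclideanSpace.single i 1)

section Geometry

variable {n : ℕ} {M : Type*} [MetricSpace M] [ChartedSpace (Model n) M]

/-- A covector at `x`. -/
abbrev Covector (n : ℕ) {M : Type*} [MetricSpace M] [ChartedSpace (Model n) M] (x : M) : Type :=
  TangentSpace (𝓡 n) x →L[ℝ] ℝ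

/-- A covariant `2`-tensor at `x`. -/
abbrev TwoTensor (n : ℕ) {M : Type*} [MetricSpace M] [ChartedSpace (Model n) M] (x : M) : Type :=
  TangentSpace (𝓡 n) x →L[ℝ] TangentSpace (𝓡 n) x →L[ℝ] ℝ

instance (x : M) : AddCommGroup (Covector n x) := ContinuousLinearMap.addCommGroup

instance (x : M) : Module ℝ (Covector n x) := ContinuousLinearMap.module

instance (x : M) : AddCommGroup (TwoTensor n x) := ContinuousLinearMap.addCommGroup

instance (x : M) : Module ℝ (TwoTensor n x) := ContinuousLinearMap.module

/-- The coordinate vector `∂/∂yᵢ` of the preferred chart at `p`, at the point with coordinates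
`y` in that chart. -/
def coordVec (p : M) (y : Model n) (i : Fin n) :
    TangentSpace (𝓡 n) ((extChartAt (𝓡 n) p).symm y) :=
  mfderiv 𝓘(ℝ, Model n) (𝓡 n) (extChartAt (𝓡 n) p).symm y (EuclideanSpace.single i (1 : ℝ))

/-- The coordinate covector `dyᵢ` at `x` of the preferred chart at `x`. -/
def coordCovec (x : M) (i : Fin n) : Covector n x :=
  (EuclideanSpace.proj i : Model n →L[ℝ] ℝ).comp
    (mfderiv (𝓡 n) 𝓘(ℝ, Model n) (extChartAt (𝓡 n) x) x)

/-- The components `θⱼ` of a `1`-form in the preferred chart at `p`. -/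
def formCoeff (θ : ∀ x : M, Covector n x) (p : M) (j : Fin n) (y : Model n) : ℝ :=
  θ ((extChartAt (𝓡 n) p).symm y) (coordVec p y j)

/-- The differential of a function, as a `1`-form. -/
def differential (f : M → ℝ) (x : M) : Covector n x :=
  mfderiv (𝓡 n) 𝓘(ℝ, ℝ) f x

variable [RiemannianBundle (fun x : M ↦ TangentSpace (𝓡 n) x)]

/-- The matrix `gᵢⱼ` of the metric in the preferred chart at `p`. -/
def metricCoeff (p : M) (y : Model n) : Matrix (Fin n) (Fin n) ℝ :=
  Matrix.of fun i j ↦ inner ℝ (coordVec p y i) (coordVec p y j)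

/-- The Christoffel symbols `Γᵏᵢⱼ` of the Levi-Civita connection in the preferred chart at `p`:
`Γᵏᵢⱼ = ½ ∑ₗ gᵏˡ (∂ᵢ gⱼₗ + ∂ⱼ gᵢₗ - ∂ₗ gᵢⱼ)`. -/
def christoffel (p : M) (k i j : Fin n) (y : Model n) : ℝ :=
  (1 / 2) * ∑ l, (metricCoeff p y)⁻¹ k l *
    (partialDeriv i (fun z ↦ metricCoeff p z j l) y
      + partialDeriv j (fun z ↦ metricCoeff p z i l) y
      - partialDeriv l (fun z ↦ metricCoeff p z i j) y)

/-- The components of the Ricci tensor in the preferred chart at `p`: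
`Ricᵢⱼ = ∂ₖ Γᵏᵢⱼ - ∂ⱼ Γᵏᵢₖ + Γᵏₖₗ Γˡᵢⱼ - Γᵏⱼₗ Γˡᵢₖ`. -/
def ricciCoeff (p : M) (y : Model n) (i j : Fin n) : ℝ :=
  ∑ k, (partialDeriv k (christoffel p k i j) y - partialDeriv j (christoffel p k i k) y)
    + ∑ k, ∑ l, (christoffel p k k l y * christoffel p l i j y
        - christoffel p k j l y * christoffel p l i k y)

/-- The Ricci tensor. -/
def ricci (x : M) : TwoTensor n x :=
  ∑ i, ∑ j, ricciCoeff x (extChartAt (𝓡 n) x x) i j •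
    (coordCovec x i).smulRight (coordCovec x j)

/-- The covariant derivative of a `1`-form for the Levi-Civita connection:
`(∇θ)ᵢⱼ = ∂ᵢ θⱼ - Γᵏᵢⱼ θₖ`. -/
def covDeriv (θ : ∀ x : M, Covector n x) (x : M) : TwoTensor n x :=
  ∑ i, ∑ j, (partialDeriv i (formCoeff θ x j) (extChartAt (𝓡 n) x x)
      - ∑ k, christoffel x k i j (extChartAt (𝓡 n) x x)
          * formCoeff θ x k (extChartAt (𝓡 n) x x)) •
    (coordCovec x i).smulRight (coordCovec x j)

/-- The Hessian `D²f = ∇ df`. -/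
def hessian (f : M → ℝ) (x : M) : TwoTensor n x :=
  covDeriv (differential f) x

instance (x : M) : FiniteDimensional ℝ (TangentSpace (𝓡 n) x) :=
  inferInstanceAs (FiniteDimensional ℝ (Model n))

/-- The vector `α♯` metrically dual to a covector `α`; thus `∇f = (df)♯`. -/
def sharp {x : M} (α : Covector n x) : TangentSpace (𝓡 n) x :=
  ∑ a, α (stdOrthonormalBasis ℝ (TangentSpace (𝓡 n) x) a) •
    stdOrthonormalBasis ℝ (TangentSpace (𝓡 n) x) a

/-- The squared norm `|α|²` of a covector. -/
def covectorNormSq {x : M} (α : Covector n x) : ℝ :=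
  ∑ a, (α (stdOrthonormalBasis ℝ (TangentSpace (𝓡 n) x) a)) ^ 2

/-- The squared (Hilbert-Schmidt) norm `|A|²` of a covariant `2`-tensor. -/
def tensorNormSq {x : M} (A : TwoTensor n x) : ℝ :=
  ∑ a, ∑ b, (A (stdOrthonormalBasis ℝ (TangentSpace (𝓡 n) x) a)
    (stdOrthonormalBasis ℝ (TangentSpace (𝓡 n) x) b)) ^ 2

/-- A `1`-form is smooth on `Ω`. -/
def SmoothFormOn [IsManifold (𝓡 n) ∞ M] (θ : ∀ x : M, Covector n x) (Ω : Set M) : Prop :=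
  ContMDiffOn (𝓡 n) ((𝓡 n).prod 𝓘(ℝ, Model n →L[ℝ] ℝ)) ∞
    (fun x ↦ Bundle.TotalSpace.mk' (Model n →L[ℝ] ℝ)
      (E := fun x : M ↦ TangentSpace (𝓡 n) x →L[ℝ] Bundle.Trivial M ℝ x) x (θ x)) Ω

variable [MeasurableSpace M]

/-- The measure `√(det gᵢⱼ) dy` on the domain of the preferred chart at `p`. -/
def chartVolume (n : ℕ) {M : Type*} [MetricSpace M] [ChartedSpace (Model n) M]
    [RiemannianBundle (fun x : M ↦ TangentSpace (𝓡 n) x)] [MeasurableSpace M] (p : M) :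
    Measure M :=
  (((volume : Measure (Model n)).restrict (extChartAt (𝓡 n) p).target).withDensity
    fun y ↦ ENNReal.ofReal (Real.sqrt (metricCoeff p y).det)).map (extChartAt (𝓡 n) p).symm

/-- The Riemannian volume measure `dv`: the least measure that dominates `√(det gᵢⱼ) dy` on the
domain of each preferred chart. The chart measures agree on overlaps and countably many charts
cover `M`, so that `dv` restricts to `√(det gᵢⱼ) dy` on every chart domain. -/
def riemannianVolume (n : ℕ) {M : Type*} [MetricSpace M] [ChartedSpace (Model n) M]
    [RiemannianBundle (fun x : M ↦ TangentSpace (𝓡 n) x)] [MeasurableSpace M] : Measure M :=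
  ⨆ p : M, chartVolume n p

end Geometry

/-- `Ω` has `C¹` boundary: near each boundary point, `Ω` is the sublevel set of a `C¹` function
with non-vanishing differential. -/
def HasC1Boundary (n : ℕ) {M : Type*} [MetricSpace M] [ChartedSpace (Model n) M]
    (Ω : Set M) : Prop :=
  ∀ p ∈ frontier Ω, ∃ (V : Set M) (ρ : M → ℝ), IsOpen V ∧ p ∈ V ∧
    ContMDiffOn (𝓡 n) 𝓘(ℝ, ℝ) 1 ρ V ∧
    (∀ q ∈ V, (differential ρ q : Covector n q) ≠ 0) ∧
    Ω ∩ V = {q ∈ V | ρ q < 0}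

/-- Strong `L²(μ)`-convergence `s k → t` of square-integrable fields, where `nsq s` is the
pointwise squared norm of the field `s`. -/
def L2Converges {M S : Type*} [MeasurableSpace M] [AddCommGroup S] (μ : Measure M)
    (nsq : S → M → ℝ) (s : ℕ → S) (t : S) : Prop :=
  (∀ k, Integrable (nsq (s k)) μ) ∧ Integrable (nsq t) μ ∧
    (∀ k, Integrable (nsq (s k - t)) μ) ∧
    Filter.Tendsto (fun k ↦ ∫ x, nsq (s k - t) x ∂μ) Filter.atTop (𝓝 0)

/-- The min-max value
`inf_{U ⊆ D, dim U = j} sup_{0 ≠ u ∈ U} (∫ num u dμ) / (∫ den u dμ)`.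
of the quadratic forms `∫ num u dμ` and `∫ den u dμ`, as an extended real number (so that no
boundedness or non-emptiness is needed to make sense of it). Elements of `D` with `∫ den u = 0`
represent the zero function; the condition on `U` says that `U` has dimension `j` modulo such
elements. -/
def minMax {M V : Type*} [MeasurableSpace M] [AddCommGroup V] [Module ℝ V] (μ : Measure M)
    (D : Set V) (num den : V → M → ℝ) (j : ℕ) : EReal :=
  ⨅ U : {U : Submodule ℝ V // Module.finrank ℝ U = j ∧
      ∀ u ∈ U, u ∈ D ∧ Integrable (num u) μ ∧ (u ≠ 0 → 0 < ∫ x, den u x ∂μ)},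
    ⨆ u : {u : V // u ∈ U.1 ∧ u ≠ 0}, (((∫ x, num u.1 x ∂μ) / (∫ x, den u.1 x ∂μ) : ℝ) : EReal)

section Spaces

variable (n : ℕ) {M : Type*} [MetricSpace M] [ChartedSpace (Model n) M]
  [RiemannianBundle (fun x : M ↦ TangentSpace (𝓡 n) x)] [MeasurableSpace M]

/-- The Riemannian volume measure of `Ω`. -/
def volumeOn (Ω : Set M) : Measure M := (riemannianVolume n).restrict Ω

/-- Pointwise square of a function. -/
def funSq (u : M → ℝ) (x : M) : ℝ := u x ^ 2

/-- Pointwise squared norm of a `1`-form. -/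
def formSq (θ : ∀ x : M, Covector n x) (x : M) : ℝ := covectorNormSq (θ x)

/-- Pointwise squared norm of a covariant `2`-tensor field. -/
def tensorSq (A : ∀ x : M, TwoTensor n x) (x : M) : ℝ := tensorNormSq (A x)

/-- `H¹(Ω)`, the completion of `C^∞(Ω)` for the norm `(∫ |∇f|² + f²)^{1/2}`, realized as the
closure of the pairs `(f, df)` in `L²`: its elements are the functions `u` together with their
differential `du`. -/
def sobolevH1 (Ω : Set M) : Set ((M → ℝ) × (∀ x : M, Covector n x)) :=
  {p | ∃ f : ℕ → M → ℝ, (∀ k, ContMDiffOn (𝓡 n) 𝓘(ℝ, ℝ) ∞ (f k) Ω) ∧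
    L2Converges (volumeOn n Ω) funSq f p.1 ∧
    L2Converges (volumeOn n Ω) (formSq n) (fun k ↦ differential (f k)) p.2}

/-- `H²(Ω)`, the completion of `C^∞(Ω)` for the norm `(∫ |D²f|² + |∇f|² + f²)^{1/2}`, realized
as the closure of the triples `(f, df, D²f)` in `L²`: its elements are the functions `u` together
with `du` and `D²u`. -/
def sobolevH2 (Ω : Set M) :
    Set ((M → ℝ) × (∀ x : M, Covector n x) × (∀ x : M, TwoTensor n x)) :=
  {p | ∃ f : ℕ → M → ℝ, (∀ k, ContMDiffOn (𝓡 n) 𝓘(ℝ, ℝ) ∞ (f k) Ω) ∧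
    L2Converges (volumeOn n Ω) funSq f p.1 ∧
    L2Converges (volumeOn n Ω) (formSq n) (fun k ↦ differential (f k)) p.2.1 ∧
    L2Converges (volumeOn n Ω) (tensorSq n) (fun k ↦ hessian (f k)) p.2.2}

/-- The space of `1`-forms of class `H¹(Ω)`: the completion of the smooth `1`-forms on `Ω` for
the norm `(∫ |∇θ|² + |θ|²)^{1/2}`, realized as the closure of the pairs `(θ, ∇θ)` in `L²`. -/
def sobolevFormH1 [IsManifold (𝓡 n) ∞ M] (Ω : Set M) :
    Set ((∀ x : M, Covector n x) × (∀ x : M, TwoTensor n x)) :=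
  {p | ∃ θ : ℕ → ∀ x : M, Covector n x, (∀ k, SmoothFormOn (θ k) Ω) ∧
    L2Converges (volumeOn n Ω) (formSq n) θ p.1 ∧
    L2Converges (volumeOn n Ω) (tensorSq n) (fun k ↦ covDeriv (θ k)) p.2}

/-- The `j`-th Neumann eigenvalue `m_j` of the Laplacian on `Ω`, with Rayleigh quotient
`∫ |∇u|² / ∫ u²` on `H¹(Ω)`. -/
def laplaceEigenvalue (Ω : Set M) (j : ℕ) : EReal :=
  minMax (volumeOn n Ω) (sobolevH1 n Ω) (fun p ↦ formSq n p.2) (fun p ↦ funSq p.1) j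

/-- The `j`-th Neumann eigenvalue `μ_j` of the biharmonic operator on `Ω`, with Rayleigh quotient
`∫ (|D²u|² + Ric(∇u, ∇u)) / ∫ u²` on `H²(Ω)`. -/
def biharmonicEigenvalue (Ω : Set M) (j : ℕ) : EReal :=
  minMax (volumeOn n Ω) (sobolevH2 n Ω)
    (fun p x ↦ tensorSq n p.2.2 x + ricci x (sharp (p.2.1 x)) (sharp (p.2.1 x)))
    (fun p ↦ funSq p.1) j

/-- The `j`-th Neumann eigenvalue `η_j` of the rough Laplacian on `1`-forms of `Ω`, with Rayleigh
quotient `∫ |∇θ|² / ∫ |θ|²` on the `1`-forms of class `H¹(Ω)`. -/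
def roughLaplaceEigenvalue [IsManifold (𝓡 n) ∞ M] (Ω : Set M) (j : ℕ) : EReal :=
  minMax (volumeOn n Ω) (sobolevFormH1 n Ω) (fun p ↦ tensorSq n p.2) (fun p ↦ formSq n p.1) j

end Spaces

end NeumannBiharmonic

end

/-! For `u` of class `H²`, the form `du` is of class `H¹` with `∇du = D²u`. Testing `η₁` on the line
through `du` gives `∫|D²u|² ≥ η₁ ∫|du|²`, and the Ricci bound adds `(n-1)K ∫|du|²`. Divided by
`∫u²`, this bounds the biharmonic quotient below by `η₁ + (n-1)K` times the Laplace quotient of the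
same function. Since `H²` maps into `H¹`, the bound passes to min-max values by
`mul_minMax_le_of_linearMap`. The test form comes from `sobolevFormH1_of_sobolevH2` together with
`minMax_one_le`. -/

noncomputable section

namespace NeumannBiharmonic

/-! ### Abstract comparison of min-max values -/

section MinMax

variable {M V : Type*} [MeasurableSpace M] [AddCommGroup V] [Module ℝ V] {μ : Measure M}
  {D : Set V} {num den : V → M → ℝ}

/-- Min-max values of positive index of non-negative forms are non-negative. -/
lemma minMax_nonneg (hnum : ∀ u x, 0 ≤ num u x) (hden : ∀ u x, 0 ≤ den u x) {j : ℕ}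
    (hj : 1 ≤ j) : 0 ≤ minMax μ D num den j := by
  refine le_iInf fun ⟨U, hU, _⟩ ↦ ?_
  have : Nontrivial U := Module.nontrivial_of_finrank_pos (R := ℝ) (by omega)
  obtain ⟨⟨u, huU⟩, hu⟩ := exists_ne (0 : U)
  refine le_trans ?_ (le_iSup _ (⟨u, huU, by simpa using hu⟩ : {u : V // u ∈ U ∧ u ≠ 0}))
  exact_mod_cast div_nonneg (integral_nonneg (hnum u)) (integral_nonneg (hden u))

/-- The first min-max value is at most the Rayleigh quotient of any element generating a line
in the form domain. -/
lemma minMax_one_le {p : V} (hD : ∀ c : ℝ, c • p ∈ D)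
    (hnum : ∀ (c : ℝ) x, num (c • p) x = c ^ 2 * num p x)
    (hden : ∀ (c : ℝ) x, den (c • p) x = c ^ 2 * den p x)
    (hint : Integrable (num p) μ) (hpos : 0 < ∫ x, den p x ∂μ) :
    minMax μ D num den 1 ≤ (((∫ x, num p x ∂μ) / (∫ x, den p x ∂μ) : ℝ) : EReal) := by
  have hp : p ≠ 0 := by
    rintro rfl
    have h0 : ∀ x, den (0 : V) x = 0 := fun x ↦ by simpa using hden 0 x
    simp [h0] at hpos
  refine iInf_le_of_le ⟨Submodule.span ℝ {p}, finrank_span_singleton hp, ?_⟩ ?_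
  · intro u hu
    obtain ⟨c, rfl⟩ := Submodule.mem_span_singleton.1 hu
    refine ⟨hD c, ?_, fun hc ↦ ?_⟩
    · rw [funext (hnum c)]
      exact hint.const_mul _
    · have hc0 : c ≠ 0 := fun h ↦ hc (by simp [h])
      simp_rw [hden c, integral_const_mul]
      positivity
  · refine iSup_le fun ⟨u, hu, hu0⟩ ↦ ?_
    obtain ⟨c, rfl⟩ := Submodule.mem_span_singleton.1 hu
    have hc0 : c ≠ 0 := fun h ↦ hu0 (by simp [h])
    simp_rw [hnum c, hden c, integral_const_mul]
    rw [mul_div_mul_left _ _ (pow_ne_zero 2 hc0)]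

/-- Comparison of min-max values along a linear map `L` between the form domains that preserves
the denominators, when the Rayleigh quotients are comparable up to a positive factor `a`. -/
lemma mul_minMax_le_of_linearMap {W : Type*} [AddCommGroup W] [Module ℝ W] {D' : Set W}
    {num' den' : W → M → ℝ} (L : V →ₗ[ℝ] W) {a : EReal} (ha : 0 < a) {j : ℕ} (hj : 1 ≤ j)
    (hD : ∀ u ∈ D, L u ∈ D') (hint : ∀ u ∈ D, Integrable (num' (L u)) μ)
    (hden : ∀ u, den' (L u) = den u) (hden0 : ∀ x, den' 0 x = 0)
    (hnum' : ∀ u x, 0 ≤ num' u x) (hden' : ∀ u x, 0 ≤ den' u x)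
    (hle : ∀ u ∈ D, (∀ c : ℝ, c • u ∈ D) → Integrable (num u) μ → 0 < ∫ x, den u x ∂μ →
      a * (((∫ x, num' (L u) x ∂μ) / (∫ x, den u x ∂μ) : ℝ) : EReal)
        ≤ (((∫ x, num u x ∂μ) / (∫ x, den u x ∂μ) : ℝ) : EReal)) :
    a * minMax μ D' num' den' j ≤ minMax μ D num den j := by
  refine le_iInf fun ⟨U, hUj, hU⟩ ↦ ?_
  -- A nonzero `u` in `U` has positive denominator and `L` preserves denominators, so the image of
  -- `U` is a competitor of the same dimension `j`.
  have hinj : ∀ u ∈ U, L u = 0 → u = 0 := by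
    intro u hu h
    by_contra hne
    have := (hU u hu).2.2 hne
    simp [← hden, h, hden0] at this
  have hfin : Module.finrank ℝ (U.map L) = j := by
    rw [← hUj]
    have hinj' : Function.Injective (L.domRestrict U) := by
      rw [← LinearMap.ker_eq_bot, LinearMap.ker_eq_bot']
      rintro ⟨u, hu⟩ h
      exact Subtype.ext (hinj u hu h)
    have h := LinearMap.finrank_range_of_inj hinj'
    rwa [LinearMap.range_domRestrict] at h
  set S : EReal := ⨆ u : {u : V // u ∈ U ∧ u ≠ 0},
    (((∫ x, num u.1 x ∂μ) / (∫ x, den u.1 x ∂μ) : ℝ) : EReal)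
  set T : EReal := ⨆ u : {u : V // u ∈ U ∧ u ≠ 0},
    (((∫ x, num' (L u.1) x ∂μ) / (∫ x, den u.1 x ∂μ) : ℝ) : EReal) with hT
  have hquot : ∀ u : {u : V // u ∈ U ∧ u ≠ 0},
      a * (((∫ x, num' (L u.1) x ∂μ) / (∫ x, den u.1 x ∂μ) : ℝ) : EReal) ≤ S := fun u ↦
    -- `D` is only a set; the multiples of `u` lie in it because `U` is a subspace contained in `D`.
    (hle u.1 (hU _ u.2.1).1 (fun c ↦ (hU _ (U.smul_mem c u.2.1)).1) (hU _ u.2.1).2.1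
      ((hU _ u.2.1).2.2 u.2.2)).trans
      (le_iSup (fun u : {u : V // u ∈ U ∧ u ≠ 0} ↦
        (((∫ x, num u.1 x ∂μ) / (∫ x, den u.1 x ∂μ) : ℝ) : EReal)) u)
  have hmT : minMax μ D' num' den' j ≤ T := by
    refine iInf_le_of_le ⟨U.map L, hfin, ?_⟩ ?_
    · rintro _ ⟨u, hu, rfl⟩
      refine ⟨hD u (hU u hu).1, hint u (hU u hu).1, fun h ↦ ?_⟩
      rw [hden]
      exact (hU u hu).2.2 fun h' ↦ h (by simp [h'])
    · refine iSup_le ?_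
      rintro ⟨_, ⟨u, hu, rfl⟩, h⟩
      rw [hden]
      exact le_iSup (fun u : {u : V // u ∈ U ∧ u ≠ 0} ↦
        (((∫ x, num' (L u.1) x ∂μ) / (∫ x, den u.1 x ∂μ) : ℝ) : EReal))
        ⟨u, hu, fun h' ↦ h (by simp [h'])⟩
  refine (mul_le_mul_of_nonneg_left hmT ha.le).trans ?_
  have hnonneg : ∀ u : {u : V // u ∈ U ∧ u ≠ 0},
      0 ≤ (((∫ x, num' (L u.1) x ∂μ) / (∫ x, den u.1 x ∂μ) : ℝ) : EReal) := fun u ↦ by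
    rw [← hden]
    exact_mod_cast div_nonneg (integral_nonneg (hnum' _)) (integral_nonneg (hden' _))
  -- Division by `a` moves it past the supremum only when `a` is finite. If `a = ⊤` and `S < ⊤`,
  -- every quotient in `T` must vanish, and `⊤ * 0 = 0`.
  rcases eq_or_ne a ⊤ with rfl | hatop
  · rcases eq_or_ne S ⊤ with hS | hS
    · simp [hS]
    have : Nontrivial U := Module.nontrivial_of_finrank_pos (R := ℝ) (by omega)
    obtain ⟨⟨u, huU⟩, hu⟩ := exists_ne (0 : U)
    have hT0 : T = 0 := by
      have hz : ∀ u : {u : V // u ∈ U ∧ u ≠ 0},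
          (((∫ x, num' (L u.1) x ∂μ) / (∫ x, den u.1 x ∂μ) : ℝ) : EReal) = 0 := by
        intro u
        by_contra hne
        have hpos := lt_of_le_of_ne (hnonneg u) (Ne.symm hne)
        have := hquot u
        rw [EReal.top_mul_of_pos hpos] at this
        exact hS (top_le_iff.1 this)
      have : Nonempty {u : V // u ∈ U ∧ u ≠ 0} := ⟨⟨u, huU, by simpa using hu⟩⟩
      rw [hT, funext hz, iSup_const]
    rw [hT0, mul_zero]
    exact (mul_nonneg le_top (hnonneg ⟨u, huU, by simpa using hu⟩)).trans (hquot _)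
  · rw [mul_comm, ← EReal.le_div_iff_mul_le ha hatop]
    refine iSup_le fun u ↦ ?_
    rw [EReal.le_div_iff_mul_le ha hatop, mul_comm]
    exact hquot u

end MinMax

/-! ### Differentials, pointwise norms and Sobolev domains -/

section Geometry

variable {n : ℕ} {M : Type*} [MetricSpace M] [ChartedSpace (Model n) M]

/-- The differential of a function that is smooth on an open set is a smooth `1`-form there. -/
lemma smoothFormOn_differential [IsManifold (𝓡 n) ∞ M] {f : M → ℝ} {Ω : Set M}
    (hΩ : IsOpen Ω) (hf : ContMDiffOn (𝓡 n) 𝓘(ℝ, ℝ) ∞ f Ω) :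
    SmoothFormOn (n := n) (differential f) Ω := by
  intro x hx
  apply ContMDiffAt.contMDiffWithinAt
  refine (contMDiffAt_hom_bundle _).2 ⟨contMDiffAt_id, ?_⟩
  convert (hf.contMDiffAt (hΩ.mem_nhds hx)).mfderiv_const (m := ∞) (by simp) using 1
  ext1 y
  -- The two coordinate expressions differ only in the target, a trivial bundle versus the tangent
  -- bundle of `ℝ`; both trivializations are the identity.
  simp only [inTangentCoordinates, ContinuousLinearMap.inCoordinates]
  have htriv : (trivializationAt ℝ (Trivial M ℝ) x).continuousLinearMapAt ℝ y =
      ContinuousLinearMap.id ℝ ℝ := Trivial.continuousLinearMapAt_trivialization ℝ M ℝ y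
  rw [htriv, TangentBundle.continuousLinearMapAt_model_space]
  rfl

variable [RiemannianBundle (fun x : M ↦ TangentSpace (𝓡 n) x)]

lemma covectorNormSq_nonneg {x : M} (α : Covector n x) : 0 ≤ covectorNormSq α :=
  Finset.sum_nonneg fun _ _ ↦ sq_nonneg _

lemma tensorNormSq_nonneg {x : M} (A : TwoTensor n x) : 0 ≤ tensorNormSq A :=
  Finset.sum_nonneg fun _ _ ↦ Finset.sum_nonneg fun _ _ ↦ sq_nonneg _

lemma covectorNormSq_smul {x : M} (c : ℝ) (α : Covector n x) :
    covectorNormSq (c • α) = c ^ 2 * covectorNormSq α := by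
  rw [covectorNormSq, covectorNormSq, Finset.mul_sum]
  exact Finset.sum_congr rfl fun _ _ ↦ mul_pow _ _ _

lemma tensorNormSq_smul {x : M} (c : ℝ) (A : TwoTensor n x) :
    tensorNormSq (c • A) = c ^ 2 * tensorNormSq A := by
  simp only [tensorNormSq, Finset.mul_sum]
  exact Finset.sum_congr rfl fun _ _ ↦ Finset.sum_congr rfl fun _ _ ↦ mul_pow _ _ _

/-- The musical isomorphism is isometric. -/
lemma inner_sharp_self {x : M} (α : Covector n x) :
    inner ℝ (sharp α) (sharp α) = covectorNormSq α := by
  rw [sharp, (stdOrthonormalBasis ℝ (TangentSpace (𝓡 n) x)).orthonormal.inner_sum,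
    covectorNormSq]
  exact Finset.sum_congr rfl fun _ _ ↦ by simp [sq]

variable [MeasurableSpace M] {Ω : Set M}

lemma sobolevH1_of_sobolevH2 {p : (M → ℝ) × (∀ x : M, Covector n x) × (∀ x : M, TwoTensor n x)}
    (hp : p ∈ sobolevH2 n Ω) : (p.1, p.2.1) ∈ sobolevH1 n Ω := by
  obtain ⟨f, hf, h0, h1, -⟩ := hp
  exact ⟨f, hf, h0, h1⟩

/-- The differential of a function of class `H²` is a `1`-form of class `H¹`. -/
lemma sobolevFormH1_of_sobolevH2 [IsManifold (𝓡 n) ∞ M] (hΩ : IsOpen Ω)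
    {p : (M → ℝ) × (∀ x : M, Covector n x) × (∀ x : M, TwoTensor n x)}
    (hp : p ∈ sobolevH2 n Ω) : p.2 ∈ sobolevFormH1 n Ω := by
  obtain ⟨f, hf, -, h1, h2⟩ := hp
  -- `h2` fits as it stands because `hessian` is by definition `covDeriv` of the differential.
  exact ⟨fun k ↦ differential (f k), fun k ↦ smoothFormOn_differential hΩ (hf k), h1, h2⟩

end Geometry

end NeumannBiharmonic

end

/-! ### The eigenvalue inequality -/

open NeumannBiharmonic in
theorem mainTheorem9 (n : ℕ) (hn : 2 ≤ n)
    {M : Type*} [MetricSpace M] [SecondCountableTopology M]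
    [ChartedSpace (EuclideanSpace ℝ (Fin n)) M] [IsManifold (𝓡 n) ∞ M]
    [RiemannianBundle (fun x : M ↦ TangentSpace (𝓡 n) x)]
    [IsContMDiffRiemannianBundle (𝓡 n) ∞ (EuclideanSpace ℝ (Fin n))
      (fun x : M ↦ TangentSpace (𝓡 n) x)]
    [IsRiemannianManifold (𝓡 n) M] [CompleteSpace M]
    [MeasurableSpace M] [BorelSpace M]
    (K : ℝ) (hK : 0 < K)
    (hRic : ∀ (x : M) (v : TangentSpace (𝓡 n) x),
      ((n : ℝ) - 1) * K * inner ℝ v v ≤ NeumannBiharmonic.ricci x v v)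
    (Ω : Set M) (hΩ_open : IsOpen Ω) (hΩ_conn : IsConnected Ω)
    (hΩ_bdd : Bornology.IsBounded Ω) (hΩ_C1 : NeumannBiharmonic.HasC1Boundary n Ω)
    (j : ℕ) (hj : 1 ≤ j) :
    (NeumannBiharmonic.roughLaplaceEigenvalue n Ω 1 + ((((n : ℝ) - 1) * K : ℝ) : EReal))
        * NeumannBiharmonic.laplaceEigenvalue n Ω j
      ≤ NeumannBiharmonic.biharmonicEigenvalue n Ω j := by
  have hc : 0 < ((n : ℝ) - 1) * K := by
    have : (2 : ℝ) ≤ n := by exact_mod_cast hn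
    exact mul_pos (by linarith) hK
  set c : ℝ := ((n : ℝ) - 1) * K
  have hη : 0 ≤ roughLaplaceEigenvalue n Ω 1 :=
    minMax_nonneg (fun u x ↦ tensorNormSq_nonneg _) (fun u x ↦ covectorNormSq_nonneg _) le_rfl
  -- The linear map is `(u, du, D²u) ↦ (u, du)`.
  refine mul_minMax_le_of_linearMap
    (LinearMap.prodMap LinearMap.id (LinearMap.fst ℝ (∀ x : M, Covector n x)
      (∀ x : M, TwoTensor n x)))
    (lt_of_lt_of_le (EReal.coe_pos.2 hc) (le_add_of_nonneg_left hη)) hj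
    (fun u hu ↦ sobolevH1_of_sobolevH2 hu) (fun u hu ↦ ?_) (fun u ↦ rfl)
    (fun x ↦ by simp [funSq]) (fun u x ↦ covectorNormSq_nonneg _) (fun u x ↦ sq_nonneg _) ?_
  · obtain ⟨f, -, -, h1, -⟩ := hu
    exact h1.2.1
  · intro u hu hmul hint hpos
    obtain ⟨f, -, -, h1, h2⟩ := hu
    have i1 : Integrable (fun x ↦ formSq n u.2.1 x) (volumeOn n Ω) := h1.2.1
    have i2 : Integrable (fun x ↦ tensorSq n u.2.2 x) (volumeOn n Ω) := h2.2.1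
    have key : (∫ x, tensorSq n u.2.2 x ∂(volumeOn n Ω))
        + c * ∫ x, formSq n u.2.1 x ∂(volumeOn n Ω)
        ≤ ∫ x, tensorSq n u.2.2 x + ricci x (sharp (u.2.1 x)) (sharp (u.2.1 x))
          ∂(volumeOn n Ω) := by
      rw [← integral_const_mul, ← integral_add i2 (i1.const_mul c)]
      refine integral_mono (i2.add (i1.const_mul c)) hint fun x ↦ ?_
      have := hRic x (sharp (u.2.1 x))
      rw [inner_sharp_self] at this
      exact add_le_add le_rfl this
    have hA : 0 ≤ ∫ x, tensorSq n u.2.2 x ∂(volumeOn n Ω) :=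
      integral_nonneg fun x ↦ tensorNormSq_nonneg _
    have hB : 0 ≤ ∫ x, formSq n u.2.1 x ∂(volumeOn n Ω) :=
      integral_nonneg fun x ↦ covectorNormSq_nonneg _
    change _ * (((∫ x, formSq n u.2.1 x ∂(volumeOn n Ω)) /
      ∫ x, funSq u.1 x ∂(volumeOn n Ω) : ℝ) : EReal) ≤ _
    -- If `∫|du|² = 0`, then `du` cannot test `η₁`, but the left side is zero and `key` makes the
    -- right side non-negative.
    rcases hB.eq_or_lt with hB0 | hBpos
    · rw [← hB0] at key ⊢
      rw [zero_div, EReal.coe_zero, mul_zero]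
      have : 0 ≤ ∫ x, tensorSq n u.2.2 x + ricci x (sharp (u.2.1 x)) (sharp (u.2.1 x))
          ∂(volumeOn n Ω) := by linarith
      exact_mod_cast div_nonneg this hpos.le
    · have hηle : roughLaplaceEigenvalue n Ω 1 ≤
          (((∫ x, tensorSq n u.2.2 x ∂(volumeOn n Ω)) /
            (∫ x, formSq n u.2.1 x ∂(volumeOn n Ω)) : ℝ) : EReal) :=
        minMax_one_le (p := u.2)
          (fun c ↦ sobolevFormH1_of_sobolevH2 (p := c • u) hΩ_open (hmul c))
          (fun c x ↦ tensorNormSq_smul c (u.2.2 x)) (fun c x ↦ covectorNormSq_smul c (u.2.1 x))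
          i2 hBpos
      refine (mul_le_mul_of_nonneg_right (add_le_add hηle le_rfl)
        (by exact_mod_cast div_nonneg hB hpos.le)).trans ?_
      -- With `A = ∫|D²u|²` and `B = ∫|du|²`, the product `(A/B + c) * B` is `A + c * B`, the left
      -- side of `key`.
      rw [← EReal.coe_add, ← EReal.coe_mul, EReal.coe_le_coe_iff, ← mul_div_assoc, add_mul,
        div_mul_cancel₀ _ hBpos.ne']
      exact div_le_div_of_nonneg_right key hpos.le
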